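/- Proposition 6. All systems $A,D,E,A',D',E'$ are finite-dimensional complex Hilbert spaces, $\mathcal{S}(\cdot)$ denotes the set of density operators (positive semidefinite, unit trace) on a system, $\sigma_A=\operatorname{tr}_E[\sigma_{AE}]$ denotes a marginal, and $\log$ is the natural logarithm. For density operators $\rho,\sigma$ on the same finite-dimensional space, the measured relative entropy is $$D^{\mathbb{M}}(\rho\|\sigma):=\sup_{(\mathcal{X},M)}D\big(P_{\rho,M}\big\|P_{\sigma,M}\big)\in[0,+\infty],\qquad P_{\rho,M}(x)=\operatorname{tr}[M(x)\rho],$$ where the supremum is over all finite sets $\mathcal{X}$ and all positive operator valued measures $M$ on $\mathcal{X}$ (that is, $M(x)\ge 0$ and $\sum_{x\in\mathcal{X}}M(x)=1$), and $D(P\|Q)=\sum_{x}P(x)\log\frac{P(x)}{Q(x)}$ (terms with $P(x)=0$ being $0$) if $P\ll Q$ and $D(P\|Q)=+\infty$ otherwise. For $\rho_{AD}\in\mathcal{S}(AD)$ and $\sigma_{AE}\in\mathcal{S}(AE)$, the measured relative entropy of recovery is $$D^{\mathbb{M},\mathrm{rec}}(\rho_{AD}\|\sigma_{AE}):=\inf_{\Gamma_{E\to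 D}}D^{\mathbb{M}}\big(\rho_{AD}\big\|(\mathcal{I}_A\otimes\Gamma_{E\to D})(\sigma_{AE})\big),$$ where the infimum is over all completely positive trace-preserving linear maps $\Gamma_{E\to D}$ from operators on $E$ to operators on $D$. Let $\rho_{AD}\in\mathcal{S}(AD)$, $\tau_{A'D'}\in\mathcal{S}(A'D')$, $\sigma_{AE}\in\mathcal{S}(AE)$ and $\omega_{A'E'}\in\mathcal{S}(A'E')$ with $\sigma_A>0$ and $\omega_{A'}>0$ (positive definite). Then $$D^{\mathbb{M},\mathrm{rec}}(\rho_{AD}\otimes\tau_{A'D'}\|\sigma_{AE}\otimes\omega_{A'E'})\ \ge\ D^{\mathbb{M},\mathrm{rec}}(\rho_{AD}\|\sigma_{AE})+D^{\mathbb{M},\mathrm{rec}}(\tau_{A'D'}\|\omega_{A'E'}),$$ where on the left-hand side the infimum is over all completely positive trace-preserving maps $\Gamma_{EE'\to DD'}$, and $AA'$ takes the role of $A$. -/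

import Mathlib

open scoped Kronecker ComplexOrder

noncomputable section

namespace RecoveryEntropy

/-- Density operators on the finite-dimensional Hilbert space `ℂ^n`: positive semidefinite, of
unit trace. -/
structure IsDensity {n : Type*} [Fintype n] (ρ : Matrix n n ℂ) : Prop where
  posSemidef : ρ.PosSemidef
  trace_eq_one : ρ.trace = 1

/-- The marginal `X_A = tr_E X_{AE}` of an operator on `A ⊗ E`. -/
def marginal {A E : Type*} [Fintype E] (X : Matrix (A × E) (A × E) ℂ) : Matrix A A ℂ :=
  Matrix.of fun a a' => ∑ e, X (a, e) (a', e)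

/-- The product `X_{AD} ⊗ Y_{A'D'}`, as an operator on `(A A') ⊗ (D D')`. -/
def systemTensor {A D A' D' : Type*} (X : Matrix (A × D) (A × D) ℂ)
    (Y : Matrix (A' × D') (A' × D') ℂ) :
    Matrix ((A × A') × (D × D')) ((A × A') × (D × D')) ℂ :=
  Matrix.reindex (Equiv.prodProdProdComm A D A' D') (Equiv.prodProdProdComm A D A' D') (X ⊗ₖ Y)

/-- The map `𝓘_A ⊗ Γ_{E → D}`: apply `Γ` to every `E`-block of an operator on `A ⊗ E`. -/
def idTensor (A : Type*) {E D : Type*} (Γ : Matrix E E ℂ →ₗ[ℂ] Matrix D D ℂ)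
    (X : Matrix (A × E) (A × E) ℂ) : Matrix (A × D) (A × D) ℂ :=
  Matrix.of fun i j => Γ (Matrix.of fun e e' => X (i.1, e) (j.1, e')) i.2 j.2

/-- Quantum channels `E → D`: completely positive and trace-preserving linear maps. -/
structure IsChannel {E D : Type*} [Fintype E] [Fintype D]
    (Γ : Matrix E E ℂ →ₗ[ℂ] Matrix D D ℂ) : Prop where
  completelyPositive : ∀ (k : ℕ) (X : Matrix (Fin k × E) (Fin k × E) ℂ),
    X.PosSemidef → (idTensor (Fin k) Γ X).PosSemidef
  trace_preserving : ∀ X : Matrix E E ℂ, (Γ X).trace = X.trace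

open Classical in
/-- Kullback–Leibler divergence `D(P‖Q)` of nonnegative weights on a finite set, with the natural
logarithm; it is `+∞` if `P` is not absolutely continuous with respect to `Q`. A term with
`P x = 0` is `0`. -/
def klDivergence {X : Type*} [Fintype X] (P Q : X → ℝ) : EReal :=
  if ∀ x, Q x = 0 → P x = 0 then ((∑ x, P x * Real.log (P x / Q x) : ℝ) : EReal) else ⊤

/-- POVMs on `ℂ^n` with outcomes in the finite set `X`. -/
structure IsPOVM {n X : Type*} [Fintype n] [DecidableEq n] [Fintype X]
    (M : X → Matrix n n ℂ) : Prop where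
  posSemidef : ∀ x, (M x).PosSemidef
  sum_eq_one : ∑ x, M x = 1

/-- The outcome weights `P_{ρ,M}(x) = tr[M(x) ρ]` (real for positive semidefinite `M x`, `ρ`). -/
def outcome {n X : Type*} [Fintype n] (ρ : Matrix n n ℂ) (M : X → Matrix n n ℂ) (x : X) : ℝ :=
  (M x * ρ).trace.re

/-- Measured relative entropy `D^𝕄(ρ‖σ)`: supremum over all POVMs with finitely many outcomes
(labelled by `Fin m`, with `m` arbitrary). -/
def measuredRelEntropy {n : Type*} [Fintype n] [DecidableEq n] (ρ σ : Matrix n n ℂ) : EReal :=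
  ⨆ (m : ℕ) (M : Fin m → Matrix n n ℂ) (_ : IsPOVM M),
    klDivergence (outcome ρ M) (outcome σ M)

/-- Measured relative entropy of recovery
`D^{𝕄,rec}(ρ_{AD}‖σ_{AE}) = inf_Γ D^𝕄(ρ_{AD} ‖ (𝓘_A ⊗ Γ_{E → D})(σ_{AE}))`, the infimum being
over all quantum channels `Γ` from `E` to `D`. -/
def measuredRelEntropyRec {A D E : Type*} [Fintype A] [Fintype D] [Fintype E] [DecidableEq A]
    [DecidableEq D] (ρ : Matrix (A × D) (A × D) ℂ) (σ : Matrix (A × E) (A × E) ℂ) : EReal :=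
  ⨅ (Γ : Matrix E E ℂ →ₗ[ℂ] Matrix D D ℂ) (_ : IsChannel Γ),
    measuredRelEntropy ρ (idTensor A Γ σ)

end RecoveryEntropy

end

open scoped Kronecker ComplexOrder

namespace RecoveryEntropy

open Matrix

/-! An infimum over channels is hard to bound below directly; it is replaced by dual certificates,
and certificates multiply under tensor products.

By the Gibbs principle, D(P‖Q) is the supremum over positive weights f of ∑ P log f − ∑ Q f + 1.
With W = ∑ f(x) M(x) and J the Choi operator of Γ, the second sum is tr[J · `link σᵀ W`], linear in
J. Sion's theorem exchanges infimum and supremum, with a multiplier Y for the constraint `marginal J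
= 1`. The outcome is `exists_dual_certificate`: each real c below the recovery entropy has M, f, Y
with `link σᵀ W` ≤ Y ⊗ 1 and c < k − tr Y + 1, where k = ∑ P log f.

The operators `link σᵀ W` are positive, so two such inequalities tensor, and every joint channel
satisfies tr[(W ⊗ W') Γ(σ ⊗ ω)] ≤ tr Y · tr Y' (`trace_mul_idTensor_systemTensor_le`). Test the
product POVM with weights f f' divided by (slightly more than) tr Y · tr Y': the linear penalty is
at most 1, leaving about k + k' − log tr Y − log tr Y'. Finally −log t ≥ 1 − t recovers c + c'. -/

/-! ### Gibbs variational principle -/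

/-- The easy half of the Gibbs variational principle, in its linearised form. -/
theorem sum_log_sub_le_klDivergence {X : Type*} [Fintype X] {P Q f : X → ℝ}
    (hP : ∀ x, 0 ≤ P x) (hQ : ∀ x, 0 ≤ Q x) (hP1 : ∑ x, P x = 1) (hf : ∀ x, 0 < f x) :
    ((∑ x, P x * Real.log (f x) - ∑ x, Q x * f x + 1 : ℝ) : EReal) ≤ klDivergence P Q := by
  unfold klDivergence
  split_ifs with hac
  · rw [EReal.coe_le_coe_iff, ← hP1, ← Finset.sum_sub_distrib, ← Finset.sum_add_distrib]
    refine Finset.sum_le_sum fun x _ => ?_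
    rcases (hP x).eq_or_lt with h | hp
    · simpa [← h] using mul_nonneg (hQ x) (hf x).le
    have hq : 0 < Q x := (hQ x).lt_of_ne' fun h => hp.ne' (hac x h)
    have h1 := Real.log_le_sub_one_of_pos (div_pos (mul_pos hq (hf x)) hp)
    rw [Real.log_div (mul_pos hq (hf x)).ne' hp.ne', Real.log_mul hq.ne' (hf x).ne'] at h1
    rw [Real.log_div hp.ne' hq.ne']
    have h2 := mul_le_mul_of_nonneg_left h1 hp.le
    have h3 : P x * (Q x * f x / P x - 1) = Q x * f x - P x := by field_simp
    rw [h3] at h2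
    linarith
  · exact le_top

/-- The Gibbs variational principle: the Kullback–Leibler divergence is approximated by its
linearised dual functional at strictly positive weights. -/
theorem exists_lt_sum_log_sub {X : Type*} [Fintype X] {P Q : X → ℝ}
    (hP : ∀ x, 0 ≤ P x) (hQ : ∀ x, 0 ≤ Q x) (hP1 : ∑ x, P x = 1) {c : ℝ}
    (hc : (c : EReal) < klDivergence P Q) :
    ∃ f : X → ℝ, (∀ x, 0 < f x) ∧ c < ∑ x, P x * Real.log (f x) - ∑ x, Q x * f x + 1 := by
  classical
  have hS : 0 ≤ ∑ x, Q x := Finset.sum_nonneg fun x _ => hQ x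
  unfold klDivergence at hc
  split_ifs at hc with hac
  · rw [EReal.coe_lt_coe_iff] at hc
    set K := ∑ x, P x * Real.log (P x / Q x)
    -- The optimal weight P/Q vanishes where P does, so it is raised to ε there; the extra cost is
    -- at most ε ∑ Q, less than K − c.
    set ε := (K - c) / (∑ x, Q x + 1)
    have hε : 0 < ε := div_pos (by linarith) (by linarith)
    have hq : ∀ x, P x ≠ 0 → 0 < Q x := fun x h => (hQ x).lt_of_ne' fun h' => h (hac x h')
    refine ⟨fun x => if P x = 0 then ε else P x / Q x, fun x => ?_, ?_⟩
    · dsimp only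
      split_ifs with h
      · exact hε
      · exact div_pos ((hP x).lt_of_ne' h) (hq x h)
    · have h1 : ∑ x, P x * Real.log (if P x = 0 then ε else P x / Q x) = K := by
        refine Finset.sum_congr rfl fun x _ => ?_
        split_ifs with h <;> simp [h]
      have h2 : ∑ x, Q x * (if P x = 0 then ε else P x / Q x) ≤ ∑ x, (P x + ε * Q x) := by
        refine Finset.sum_le_sum fun x _ => ?_
        split_ifs with h
        · rw [h]; linarith
        · rw [mul_div_cancel₀ _ (hq x h).ne']
          have := mul_nonneg hε.le (hQ x)
          linarith
      rw [Finset.sum_add_distrib, hP1, ← Finset.mul_sum] at h2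
      have h3 : ε * (∑ x, Q x + 1) = K - c := div_mul_cancel₀ _ (by linarith)
      rw [h1]
      nlinarith
  · push Not at hac
    obtain ⟨z, hz, hPz⟩ := hac
    have hPz' : 0 < P z := (hP z).lt_of_ne' hPz
    -- At z the weight costs nothing, since Q z = 0, and is chosen so that the functional equals c +
    -- 1.
    refine ⟨fun x => if x = z then Real.exp ((c + ∑ x, Q x) / P z) else 1, fun x => ?_, ?_⟩
    · dsimp only
      split_ifs
      · exact Real.exp_pos _
      · exact one_pos
    · have h1 : ∑ x, P x * Real.log (if x = z then Real.exp ((c + ∑ x, Q x) / P z) else 1)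
          = c + ∑ x, Q x := by
        rw [Finset.sum_eq_single z]
        · rw [if_pos rfl, Real.log_exp, mul_div_cancel₀ _ hPz]
        · intro b _ hb
          simp [hb]
        · simp
      have h2 : ∑ x, Q x * (if x = z then Real.exp ((c + ∑ x, Q x) / P z) else 1)
          = ∑ x, Q x := by
        refine Finset.sum_congr rfl fun x _ => ?_
        split_ifs with h <;> simp [h, hz]
      rw [h1, h2]
      linarith

/-! ### Traces, outcome weights and relabelling of POVMs -/

section Trace

variable {n : Type*} [Fintype n]

open scoped MatrixOrder in
theorem trace_mul_nonneg {A B : Matrix n n ℂ} (hA : A.PosSemidef) (hB : B.PosSemidef) :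
    0 ≤ (A * B).trace := by
  classical
  obtain ⟨C, rfl⟩ := CStarAlgebra.nonneg_iff_eq_star_mul_self.1 hA.nonneg
  rw [star_eq_conjTranspose, Matrix.mul_assoc, Matrix.trace_mul_comm]
  exact (hB.mul_mul_conjTranspose_same C).trace_nonneg

variable [DecidableEq n] {X : Type*} [Fintype X]

theorem outcome_nonneg {ρ : Matrix n n ℂ} {M : X → Matrix n n ℂ} (hρ : ρ.PosSemidef)
    (hM : IsPOVM M) (x : X) : 0 ≤ outcome ρ M x :=
  (Complex.nonneg_iff.1 (trace_mul_nonneg (hM.posSemidef x) hρ)).1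

theorem sum_outcome {ρ : Matrix n n ℂ} {M : X → Matrix n n ℂ} (hρ : ρ.trace = 1)
    (hM : IsPOVM M) : ∑ x, outcome ρ M x = 1 := by
  simp only [outcome]
  rw [← Complex.re_sum, ← Matrix.trace_sum, ← Finset.sum_mul, hM.sum_eq_one, one_mul, hρ,
    Complex.one_re]

omit [DecidableEq n] in
theorem sum_outcome_mul (ρ : Matrix n n ℂ) (M : X → Matrix n n ℂ) (f : X → ℝ) :
    ∑ x, outcome ρ M x * f x = ((∑ x, (f x) • M x) * ρ).trace.re := by
  simp only [outcome, Finset.sum_mul, Matrix.trace_sum, Complex.re_sum, Matrix.smul_mul,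
    Matrix.trace_smul, Complex.smul_re, smul_eq_mul, mul_comm]

theorem klDivergence_comp_equiv {Y : Type*} [Fintype Y] (e : Y ≃ X) (P Q : X → ℝ) :
    klDivergence (P ∘ e) (Q ∘ e) = klDivergence P Q := by
  unfold klDivergence
  have h : (∀ y, (Q ∘ e) y = 0 → (P ∘ e) y = 0) ↔ ∀ x, Q x = 0 → P x = 0 :=
    e.forall_congr_left.trans (by simp)
  have h' : ∑ y, (P ∘ e) y * Real.log ((P ∘ e) y / (Q ∘ e) y) = ∑ x, P x * Real.log (P x / Q x) :=
    e.sum_comp fun x => P x * Real.log (P x / Q x)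
  simp only [h, h']

/-- POVMs with outcomes in an arbitrary finite type bound the measured relative entropy. -/
theorem klDivergence_le_measuredRelEntropy {ρ σ : Matrix n n ℂ} {M : X → Matrix n n ℂ}
    (hM : IsPOVM M) : klDivergence (outcome ρ M) (outcome σ M) ≤ measuredRelEntropy ρ σ := by
  let e := (Fintype.equivFin X).symm
  have hM' : IsPOVM (M ∘ e) :=
    ⟨fun x => hM.posSemidef _, (e.sum_comp M).trans hM.sum_eq_one⟩
  rw [← klDivergence_comp_equiv e]
  exact le_iSup_of_le _ (le_iSup_of_le (M ∘ e) (le_iSup_of_le hM' le_rfl))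

end Trace

/-! ### Link products -/

section Link

variable {K I J : Type*} [Fintype K]

/-- The link product: contraction of two operators over a common system `K`. -/
def link (X : Matrix (K × I) (K × I) ℂ) (Z : Matrix (K × J) (K × J) ℂ) :
    Matrix (I × J) (I × J) ℂ :=
  Matrix.of fun p q => ∑ k, ∑ l, X (k, p.1) (l, q.1) * Z (k, p.2) (l, q.2)

/-- The contraction over K is a congruence of X ⊗ Z by the 0-1 matrix B that matches the two copies
of K. -/
theorem posSemidef_link [Fintype I] [Fintype J] {X : Matrix (K × I) (K × I) ℂ}
    {Z : Matrix (K × J) (K × J) ℂ} (hX : X.PosSemidef) (hZ : Z.PosSemidef) :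
    (link X Z).PosSemidef := by
  classical
  let B : Matrix (I × J) ((K × I) × (K × J)) ℂ :=
    Matrix.of fun p s => if s.1.1 = s.2.1 ∧ s.1.2 = p.1 ∧ s.2.2 = p.2 then 1 else 0
  have h : link X Z = B * (X ⊗ₖ Z) * Bᴴ := by
    ext p q
    simp only [link, B, of_apply, mul_apply, conjTranspose_apply, kroneckerMap_apply,
      Fintype.sum_prod_type, ite_and, apply_ite star, star_one, star_zero, ite_mul, one_mul,
      zero_mul, mul_ite, mul_one, mul_zero, Finset.sum_ite_eq', Finset.sum_ite_eq, Finset.mem_univ,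
      Finset.sum_ite_irrel, Finset.sum_const_zero, if_true]
    exact Finset.sum_comm
  rw [h]
  exact (hX.kronecker hZ).mul_mul_conjTranspose_same B

theorem link_add (X : Matrix (K × I) (K × I) ℂ) (Z Z' : Matrix (K × J) (K × J) ℂ) :
    link X (Z + Z') = link X Z + link X Z' := by
  ext p q
  simp [link, mul_add, Finset.sum_add_distrib]

theorem link_smul (r : ℝ) (X : Matrix (K × I) (K × I) ℂ) (Z : Matrix (K × J) (K × J) ℂ) :
    link X (r • Z) = r • link X Z := by
  ext p q
  simp [link, Finset.mul_sum, mul_left_comm]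

end Link

/-! ### Choi operators and channels -/

section Choi

variable {A E D : Type*} [Fintype A] [Fintype E] [Fintype D]

/-- The linear map with a given Choi operator. -/
def ofChoi (J : Matrix (E × D) (E × D) ℂ) : Matrix E E ℂ →ₗ[ℂ] Matrix D D ℂ where
  toFun X := Matrix.of fun d d' => ∑ e, ∑ e', X e e' * J (e, d) (e', d')
  map_add' X Y := by
    ext d d'
    simp [add_mul, Finset.sum_add_distrib]
  map_smul' r X := by
    ext d d'
    simp [Finset.mul_sum, mul_assoc]

/-- The Choi operator of a linear map. -/
def choi [DecidableEq E] (Γ : Matrix E E ℂ →ₗ[ℂ] Matrix D D ℂ) : Matrix (E × D) (E × D) ℂ :=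
  Matrix.of fun p q => Γ (Matrix.single p.1 q.1 1) p.2 q.2

omit [Fintype D] in
theorem ofChoi_choi [DecidableEq E] (Γ : Matrix E E ℂ →ₗ[ℂ] Matrix D D ℂ) :
    ofChoi (choi Γ) = Γ := by
  refine LinearMap.ext fun X => ?_
  conv_rhs => rw [Matrix.matrix_eq_sum_single X]
  ext d d'
  simp only [map_sum, Matrix.sum_apply]
  refine Finset.sum_congr rfl fun e _ => Finset.sum_congr rfl fun e' _ => ?_
  rw [← mul_one (X e e'), ← smul_eq_mul (X e e') (1 : ℂ), ← Matrix.smul_single, map_smul]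
  simp [choi]

omit [Fintype A] [Fintype D] in
theorem idTensor_ofChoi (J : Matrix (E × D) (E × D) ℂ) (X : Matrix (A × E) (A × E) ℂ) :
    idTensor A (ofChoi J) X = link (X.submatrix Prod.swap Prod.swap) J := rfl

theorem trace_ofChoi [DecidableEq E] (J : Matrix (E × D) (E × D) ℂ) (X : Matrix E E ℂ) :
    (ofChoi J X).trace = (marginal J * Xᵀ).trace := by
  simp only [Matrix.trace, ofChoi, LinearMap.coe_mk, AddHom.coe_mk, Matrix.diag_apply, of_apply,
    mul_apply, marginal, transpose_apply, Finset.sum_mul]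
  rw [Finset.sum_comm]
  refine Finset.sum_congr rfl fun e _ => ?_
  rw [Finset.sum_comm]
  exact Finset.sum_congr rfl fun _ _ => Finset.sum_congr rfl fun _ _ => mul_comm _ _

theorem posSemidef_idTensor_ofChoi {J : Matrix (E × D) (E × D) ℂ} (hJ : J.PosSemidef)
    {X : Matrix (A × E) (A × E) ℂ} (hX : X.PosSemidef) :
    (idTensor A (ofChoi J) X).PosSemidef := by
  rw [idTensor_ofChoi]
  exact posSemidef_link (hX.submatrix _) hJ

theorem isChannel_ofChoi [DecidableEq E] {J : Matrix (E × D) (E × D) ℂ} (hJ : J.PosSemidef)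
    (hJ1 : marginal J = 1) : IsChannel (ofChoi J) where
  completelyPositive _ _ hX := posSemidef_idTensor_ofChoi hJ hX
  trace_preserving X := by rw [trace_ofChoi, hJ1, one_mul, trace_transpose]

theorem IsChannel.marginal_choi [DecidableEq E] {Γ : Matrix E E ℂ →ₗ[ℂ] Matrix D D ℂ}
    (hΓ : IsChannel Γ) : marginal (choi Γ) = 1 := by
  ext e e'
  have := hΓ.trace_preserving (Matrix.single e e' 1)
  rw [Matrix.trace] at this
  rw [marginal, of_apply, Matrix.one_apply]
  refine this.trans ?_
  split_ifs with h
  · subst h; simp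
  · simp [h]

/-- The Choi operator is the image of the unnormalised maximally entangled projector v v*, with the
reference copy of E relabelled by `Fin`, as complete positivity is stated there. -/
theorem IsChannel.posSemidef_choi [DecidableEq E] {Γ : Matrix E E ℂ →ₗ[ℂ] Matrix D D ℂ}
    (hΓ : IsChannel Γ) : (choi Γ).PosSemidef := by
  let ε := Fintype.equivFin E
  let v : Fin (Fintype.card E) × E → ℂ := fun p => if ε p.2 = p.1 then 1 else 0
  have h := hΓ.completelyPositive _ _ (posSemidef_vecMulVec_self_star v)
  convert h.submatrix (Prod.map ε id) using 1
  ext p q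
  have key : Matrix.single p.1 q.1 1 =
      Matrix.of fun e e' => vecMulVec v (star v) (ε p.1, e) (ε q.1, e') := by
    ext e e'
    simp only [v, vecMulVec_apply, Pi.star_apply, Matrix.single_apply, of_apply,
      EmbeddingLike.apply_eq_iff_eq, apply_ite star, star_one, star_zero, ite_and, mul_ite,
      mul_one, mul_zero]
    grind
  simp only [choi, idTensor, submatrix_apply, of_apply, key]
  rfl

/-- Moving the action of a channel onto a test operator. -/
theorem trace_mul_idTensor_ofChoi (J : Matrix (E × D) (E × D) ℂ) (σ : Matrix (A × E) (A × E) ℂ)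
    (W : Matrix (A × D) (A × D) ℂ) :
    (W * idTensor A (ofChoi J) σ).trace = (J * link σᵀ W).trace := by
  let e : A × D × A × D × E × E ≃ E × D × E × D × A × A :=
    { toFun := fun ⟨a, d, a', d', e, e'⟩ => ⟨e, d', e', d, a, a'⟩
      invFun := fun ⟨e, d', e', d, a, a'⟩ => ⟨a, d, a', d', e, e'⟩
      left_inv := fun _ => rfl
      right_inv := fun _ => rfl }
  have h := e.sum_comp fun ⟨x, x1, x2, x3, x4, x5⟩ =>
    J (x, x1) (x2, x3) * (σ (x5, x) (x4, x2) * W (x4, x3) (x5, x1))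
  simp only [Fintype.sum_prod_type, e, Equiv.coe_fn_mk] at h
  simp only [Matrix.trace, Matrix.diag_apply, mul_apply, idTensor_ofChoi, link, of_apply,
    Fintype.sum_prod_type, submatrix_apply, Prod.swap_prod_mk, transpose_apply, Finset.mul_sum]
  rw [← h]
  refine Finset.sum_congr rfl fun _ _ => Finset.sum_congr rfl fun _ _ => Finset.sum_congr rfl
    fun _ _ => Finset.sum_congr rfl fun _ _ => Finset.sum_congr rfl fun _ _ =>
    Finset.sum_congr rfl fun _ _ => by ring

theorem trace_idTensor {Γ : Matrix E E ℂ →ₗ[ℂ] Matrix D D ℂ} (hΓ : IsChannel Γ)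
    (X : Matrix (A × E) (A × E) ℂ) : (idTensor A Γ X).trace = X.trace := by
  simp only [Matrix.trace, Fintype.sum_prod_type, Matrix.diag_apply, idTensor, of_apply]
  exact Finset.sum_congr rfl fun a _ => hΓ.trace_preserving _

theorem trace_mul_kronecker_one [DecidableEq D] (J : Matrix (E × D) (E × D) ℂ) (Y : Matrix E E ℂ) :
    (J * (Y ⊗ₖ (1 : Matrix D D ℂ))).trace = (marginal J * Y).trace := by
  simp only [Matrix.trace, Matrix.diag_apply, mul_apply, Fintype.sum_prod_type, marginal, of_apply,
    kroneckerMap_apply, Matrix.one_apply, mul_ite, mul_one, mul_zero, Finset.sum_ite_eq',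
    Finset.mem_univ, if_true, Finset.sum_mul]
  exact Finset.sum_congr rfl fun e _ => Finset.sum_comm

end Choi

/-! ### Compactness and convexity of positive operators of fixed trace -/

section Compact

variable {n : Type*} [Fintype n]

theorem isClosed_posSemidef : IsClosed {J : Matrix n n ℂ | J.PosSemidef} := by
  simp only [posSemidef_iff_dotProduct_mulVec, Set.ofPred_and, Set.ofPred_forall]
  refine IsClosed.inter ?_ (isClosed_iInter fun v => ?_)
  · exact isClosed_eq (by fun_prop) continuous_id
  · exact isClosed_le continuous_const (by fun_prop)

/-- Nonnegative 2 × 2 principal minors bound |J i j|² by the product of two diagonal entries, each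
at most the trace. -/
theorem norm_apply_le_of_posSemidef {J : Matrix n n ℂ} (hJ : J.PosSemidef) (i j : n) :
    ‖J i j‖ ≤ J.trace.re := by
  have hdiag : ∀ k, 0 ≤ (J k k).re := fun k => (Complex.nonneg_iff.1 hJ.diag_nonneg).1
  have him : ∀ k, (J k k).im = 0 := fun k => (Complex.nonneg_iff.1 hJ.diag_nonneg).2.symm
  have hle : ∀ k, (J k k).re ≤ J.trace.re := fun k => by
    simp only [Matrix.trace, Complex.re_sum, Matrix.diag_apply]
    exact Finset.single_le_sum (f := fun k => (J k k).re) (fun k _ => hdiag k) (Finset.mem_univ k)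
  have hdet := (Complex.nonneg_iff.1 (hJ.submatrix ![i, j]).det_nonneg).1
  rw [Matrix.det_fin_two] at hdet
  simp only [submatrix_apply, cons_val_zero, cons_val_one] at hdet
  rw [← hJ.isHermitian.apply j i, Complex.star_def, Complex.mul_conj, Complex.sub_re,
    Complex.mul_re, him, him, Complex.ofReal_re, Complex.normSq_eq_norm_sq] at hdet
  have := mul_le_mul (hle i) (hle j) (hdiag j) ((hdiag i).trans (hle i))
  refine le_of_sq_le_sq ?_ ((hdiag i).trans (hle i))
  nlinarith

theorem isCompact_posSemidef_trace_eq (d : ℂ) :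
    IsCompact {J : Matrix n n ℂ | J.PosSemidef ∧ J.trace = d} := by
  have hK : IsCompact (Set.univ.pi fun _ : n => Set.univ.pi fun _ : n =>
      Metric.closedBall (0 : ℂ) d.re) :=
    isCompact_univ_pi fun _ => isCompact_univ_pi fun _ => isCompact_closedBall _ _
  refine hK.of_isClosed_subset ?_ ?_
  · exact isClosed_posSemidef.inter (isClosed_eq (by fun_prop) continuous_const)
  · rintro J ⟨hJ, rfl⟩ i - j -
    simpa using norm_apply_le_of_posSemidef hJ i j

theorem convex_posSemidef_trace_eq (d : ℂ) :
    Convex ℝ {J : Matrix n n ℂ | J.PosSemidef ∧ J.trace = d} := by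
  rintro J ⟨hJ, hJd⟩ K ⟨hK, hKd⟩ a b ha hb hab
  refine ⟨(hJ.smul ha).add (hK.smul hb), ?_⟩
  rw [trace_add, trace_smul, trace_smul, hJd, hKd, ← add_smul, hab, one_smul]

end Compact

/-! ### Minimax and strong duality -/

section Duality

variable {A D E : Type*} [Fintype A] [Fintype D] [Fintype E] [DecidableEq A] [DecidableEq D]

omit [Fintype E] [DecidableEq D] in
theorem isHermitian_marginal {J : Matrix (E × D) (E × D) ℂ} (hJ : J.IsHermitian) :
    (marginal J).IsHermitian := by
  ext e e'
  simp [marginal, ← hJ.apply (e, _) (e', _)]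

/-- Dual variables for the measured relative entropy of recovery: the triples
`(tr[ρ ∑ x, log f(x) M(x)], ∑ x, f(x) M(x), Y)` for a POVM `M`, positive weights `f` and
a self-adjoint `Y`. -/
def dualSet (E : Type*) (ρ : Matrix (A × D) (A × D) ℂ) :
    Set (ℝ × Matrix (A × D) (A × D) ℂ × Matrix E E ℂ) :=
  {y | ∃ (m : ℕ) (M : Fin m → Matrix (A × D) (A × D) ℂ) (f : Fin m → ℝ), IsPOVM M ∧
    (∀ x, 0 < f x) ∧ y.1 = ∑ x, outcome ρ M x * Real.log (f x) ∧ y.2.1 = ∑ x, f x • M x ∧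
    y.2.2.IsHermitian}

-- Convex combination means randomising between the two measurements: concatenate the POVMs scaled
-- by a and b, leaving the weights unchanged. Keeping the logarithmic sum as a separate coordinate
-- makes it combine linearly too.
omit [Fintype E] in
theorem convex_dualSet (ρ : Matrix (A × D) (A × D) ℂ) : Convex ℝ (dualSet E ρ) := by
  rintro ⟨k, W, Y⟩ ⟨m, M, f, hM, hf, hk, hW, hY⟩ ⟨k', W', Y'⟩ ⟨m', M', f', hM', hf', hk', hW', hY'⟩
    a b ha hb hab
  dsimp only at hk hW hY hk' hW' hY'
  refine ⟨m + m', Fin.append (fun x => a • M x) (fun x => b • M' x), Fin.append f f',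
    ⟨fun x => ?_, ?_⟩, fun x => ?_, ?_, ?_, ?_⟩
  · induction x using Fin.addCases with
    | left i => simpa using (hM.posSemidef i).smul ha
    | right i => simpa using (hM'.posSemidef i).smul hb
  · simp only [Fin.sum_univ_add, Fin.append_left, Fin.append_right]
    rw [← Finset.smul_sum, ← Finset.smul_sum, hM.sum_eq_one, hM'.sum_eq_one, ← add_smul, hab,
      one_smul]
  · induction x using Fin.addCases with
    | left i => simpa using hf i
    | right i => simpa using hf' i
  · simp [Fin.sum_univ_add, outcome, hk, hk', Finset.mul_sum, mul_assoc]
  · simp [Fin.sum_univ_add, hW, hW', Finset.smul_sum, smul_smul, mul_comm]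
  · change (a • Y + b • Y').IsHermitian
    rw [IsHermitian, conjTranspose_add, conjTranspose_smul, conjTranspose_smul, hY, hY',
      star_trivial, star_trivial]

/-- The Lagrangian coupling a Choi operator `J` to dual variables. -/
def lagrangian (σ : Matrix (A × E) (A × E) ℂ) (J : Matrix (E × D) (E × D) ℂ)
    (y : ℝ × Matrix (A × D) (A × D) ℂ × Matrix E E ℂ) : ℝ :=
  y.1 + (J * (y.2.2 ⊗ₖ (1 : Matrix D D ℂ) - link σᵀ y.2.1)).trace.re - y.2.2.trace.re + 1

variable {ρ : Matrix (A × D) (A × D) ℂ} {σ : Matrix (A × E) (A × E) ℂ}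

omit [DecidableEq A] in
theorem lagrangian_add_left (J K : Matrix (E × D) (E × D) ℂ)
    (y : ℝ × Matrix (A × D) (A × D) ℂ × Matrix E E ℂ) {a b : ℝ} (hab : a + b = 1) :
    lagrangian σ (a • J + b • K) y = a * lagrangian σ J y + b * lagrangian σ K y := by
  obtain rfl : b = 1 - a := by linarith
  simp only [lagrangian, Matrix.add_mul, Matrix.smul_mul, trace_add, trace_smul, Complex.add_re,
    Complex.smul_re, smul_eq_mul]
  ring

omit [DecidableEq A] in
theorem lagrangian_add_right (J : Matrix (E × D) (E × D) ℂ)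
    (y z : ℝ × Matrix (A × D) (A × D) ℂ × Matrix E E ℂ) {a b : ℝ} (hab : a + b = 1) :
    lagrangian σ J (a • y + b • z) = a * lagrangian σ J y + b * lagrangian σ J z := by
  obtain rfl : b = 1 - a := by linarith
  simp only [lagrangian, Prod.fst_add, Prod.snd_add, Prod.smul_fst, Prod.smul_snd, link_add,
    link_smul, add_kronecker, smul_kronecker, Matrix.mul_add, Matrix.mul_sub, Matrix.mul_smul,
    trace_add, trace_sub, trace_smul, Complex.add_re, Complex.sub_re, Complex.smul_re, smul_eq_mul]
  ring

/-- At each positive operator `J`, the supremum of the Lagrangian dominates the measured relative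
entropy of recovery (it is infinite if `J` is not the Choi operator of a channel). -/
theorem exists_lt_lagrangian (hρ : IsDensity ρ) (hσ : IsDensity σ) {c : ℝ}
    (hc : (c : EReal) < measuredRelEntropyRec ρ σ) {J : Matrix (E × D) (E × D) ℂ}
    (hJ : J.PosSemidef) : ∃ y ∈ dualSet E ρ, c < lagrangian σ J y := by
  classical
  by_cases hJ1 : marginal J = 1
  · have hΓ := isChannel_ofChoi hJ hJ1
    have hc' := hc.trans_le (iInf₂_le (ofChoi J) hΓ)
    simp only [measuredRelEntropy, lt_iSup_iff] at hc'
    obtain ⟨m, M, hM, hc'⟩ := hc'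
    obtain ⟨f, hf, h⟩ := exists_lt_sum_log_sub (outcome_nonneg hρ.posSemidef hM)
      (outcome_nonneg (posSemidef_idTensor_ofChoi hJ hσ.posSemidef) hM)
      (sum_outcome hρ.trace_eq_one hM) hc'
    -- For a channel the multiplier is not needed: at Y = 0 the Lagrangian is the Gibbs functional.
    refine ⟨(∑ x, outcome ρ M x * Real.log (f x), ∑ x, f x • M x, 0),
      ⟨m, M, f, hM, hf, rfl, rfl, isHermitian_zero⟩, h.trans_eq ?_⟩
    rw [sum_outcome_mul (idTensor A (ofChoi J) σ), trace_mul_idTensor_ofChoi]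
    simp [lagrangian]
    ring
  -- If the constraint fails, Y = s B contributes s tr(B²) with tr(B²) > 0; with the trivial POVM
  -- and f = 1, this s makes the Lagrangian c + 1.
  · set B := marginal J - 1 with hB
    have hBH : B.IsHermitian := (isHermitian_marginal hJ.isHermitian).sub isHermitian_one
    have hβ : 0 < (B * B).trace.re := by
      have h0 := (posSemidef_conjTranspose_mul_self B).trace_nonneg
      have h1 : (Bᴴ * B).trace ≠ 0 := by
        rw [Ne, trace_conjTranspose_mul_self_eq_zero_iff]
        exact sub_ne_zero.2 hJ1
      rw [hBH] at h0 h1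
      exact (Complex.pos_iff.1 (h0.lt_of_ne' h1)).1
    set t := (J * link σᵀ (1 : Matrix (A × D) (A × D) ℂ)).trace.re with ht
    set s : ℝ := (c + t) / (B * B).trace.re with hs
    refine ⟨(0, 1, s • B), ⟨1, fun _ => 1, fun _ => 1, ⟨fun _ => PosSemidef.one, by simp⟩,
      by simp, by simp, by simp, ?_⟩, ?_⟩
    · change (s • B).IsHermitian
      rw [IsHermitian, conjTranspose_smul, hBH, star_trivial]
    · have h1 : (J * ((s • B) ⊗ₖ (1 : Matrix D D ℂ))).trace.re - (s • B).trace.re = c + t := by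
        rw [trace_mul_kronecker_one, ← Complex.sub_re, ← trace_sub]
        have h2 : marginal J * s • B - s • B = s • (B * B) := by
          rw [Matrix.mul_smul, ← smul_sub]
          congr 1
          rw [hB]; noncomm_ring
        rw [h2, trace_smul, Complex.smul_re, smul_eq_mul, hs, div_mul_cancel₀ _ hβ.ne']
      simp only [lagrangian, Matrix.mul_sub, trace_sub, Complex.sub_re, ← ht]
      linarith

/-- Minimax duality for the measured relative entropy of recovery. -/
theorem exists_forall_lt_lagrangian (hρ : IsDensity ρ) (hσ : IsDensity σ) {c : ℝ}
    (hc : (c : EReal) < measuredRelEntropyRec ρ σ) (d : ℂ)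
    (hd : {J : Matrix (E × D) (E × D) ℂ | J.PosSemidef ∧ J.trace = d}.Nonempty) :
    ∃ y ∈ dualSet E ρ, ∀ J : Matrix (E × D) (E × D) ℂ, J.PosSemidef → J.trace = d →
      c < lagrangian σ J y := by
  set 𝒥 := {J : Matrix (E × D) (E × D) ℂ | J.PosSemidef ∧ J.trace = d}
  have hcont1 : ∀ y, Continuous fun J : Matrix (E × D) (E × D) ℂ => lagrangian σ J y := by
    intro y
    unfold lagrangian
    fun_prop
  have hcont2 : ∀ J, Continuous fun y : ℝ × Matrix (A × D) (A × D) ℂ × Matrix E E ℂ =>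
      lagrangian σ J y := by
    intro J
    have hk : Continuous fun Y : Matrix E E ℂ => Y ⊗ₖ (1 : Matrix D D ℂ) :=
      continuous_matrix fun i j => by
        simp only [kroneckerMap_apply]
        fun_prop
    have hl : Continuous fun W : Matrix (A × D) (A × D) ℂ => link σᵀ W :=
      continuous_matrix fun i j => by
        simp only [link, of_apply]
        fun_prop
    unfold lagrangian
    fun_prop
  have hJc : Convex ℝ 𝒥 := convex_posSemidef_trace_eq d
  -- The dual set is not compact, but by compactness of 𝒥 finitely many dual points already beat c
  -- everywhere; Sion's theorem merges them into one.
  obtain ⟨t, ht, htc⟩ := (isCompact_posSemidef_trace_eq d).elim_finite_subcover_image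
    (b := dualSet E ρ) (c := fun y => {J | c < lagrangian σ J y})
    (fun y _ => isOpen_lt continuous_const (hcont1 y))
    (fun J hJ => by
      obtain ⟨y, hy, h⟩ := exists_lt_lagrangian hρ hσ hc hJ.1
      exact Set.mem_biUnion hy h)
  obtain ⟨y, hy, h⟩ := Sion.exists_lt_iInf_of_lt_iInf_of_finite (X := 𝒥) (Y := dualSet E ρ)
    (f := lagrangian σ) hd (isCompact_posSemidef_trace_eq d)
    (fun y _ => (hcont1 y).lowerSemicontinuous.lowerSemicontinuousOn _)
    (fun y _ => ConvexOn.quasiconvexOn ⟨hJc, fun J _ K _ a b _ _ hab =>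
      (lagrangian_add_left J K y hab).le⟩)
    (convex_dualSet ρ)
    (fun J _ => (hcont2 J).upperSemicontinuous.upperSemicontinuousOn _)
    (fun J _ => ConcaveOn.quasiconcaveOn ⟨convex_dualSet ρ, fun y _ z _ a b _ _ hab =>
      (lagrangian_add_right J y z hab).ge⟩)
    hJc htc.1 ht (t := c) (fun J hJ => by simpa using htc.2 hJ)
  exact ⟨y, hy, fun J h1 h2 => h J ⟨h1, h2⟩⟩

/-- Strong duality: below the measured relative entropy of recovery there is a POVM with positive
weights `f` and an operator `Y` that certifies the bound for all channels simultaneously. -/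
theorem exists_dual_certificate (hρ : IsDensity ρ) (hσ : IsDensity σ) {c : ℝ}
    (hc : (c : EReal) < measuredRelEntropyRec ρ σ) :
    ∃ (m : ℕ) (M : Fin m → Matrix (A × D) (A × D) ℂ) (f : Fin m → ℝ) (Y : Matrix E E ℂ),
      IsPOVM M ∧ (∀ x, 0 < f x) ∧
      (Y ⊗ₖ (1 : Matrix D D ℂ) - link σᵀ (∑ x, f x • M x)).PosSemidef ∧
      c < ∑ x, outcome ρ M x * Real.log (f x) - Y.trace.re + 1 := by
  classical
  have : Nonempty D := by
    by_contra h
    rw [not_nonempty_iff] at h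
    simpa [Matrix.trace] using hρ.trace_eq_one
  have : Nonempty E := by
    by_contra h
    rw [not_nonempty_iff] at h
    simpa [Matrix.trace] using hσ.trace_eq_one
  -- The shift of Y below brings the dual value down to exactly c', so c' must exceed c.
  obtain ⟨c', hcc', hc'⟩ := EReal.lt_iff_exists_real_btwn.1 hc
  rw [EReal.coe_lt_coe_iff] at hcc'
  -- Every J with marginal 1 has trace |E|, so fixing this trace loses no channel and makes the
  -- domain compact.
  set N : ℝ := (Fintype.card E : ℝ) with hN
  have hN0 : 0 < N := by simp [hN, Fintype.card_pos]
  have hscale : ∀ v : E × D → ℂ, v ≠ 0 → ∃ r : ℝ, 0 < r ∧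
      (r • vecMulVec v (star v)).trace = (N : ℂ) := by
    intro v hv
    have h0 : 0 < v ⬝ᵥ star v := by
      rwa [dotProduct_comm, dotProduct_star_self_pos_iff]
    obtain ⟨h1, h2⟩ := Complex.pos_iff.1 h0
    refine ⟨N / (v ⬝ᵥ star v).re, div_pos hN0 h1, ?_⟩
    rw [trace_smul, trace_vecMulVec]
    apply Complex.ext
    · rw [Complex.smul_re, smul_eq_mul, div_mul_cancel₀ _ h1.ne', Complex.ofReal_re]
    · rw [Complex.smul_im, ← h2]; simp
  obtain ⟨⟨k, W, Y⟩, ⟨m, M, f, hM, hf, rfl, rfl, hY⟩, h⟩ :=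
    exists_forall_lt_lagrangian hρ hσ hc' (N : ℂ) (by
      obtain ⟨r, hr, h⟩ := hscale (fun _ => 1) (fun h => by
        simpa using congrFun h (Classical.arbitrary _))
      exact ⟨_, (posSemidef_vecMulVec_self_star _).smul hr.le, h⟩)
  dsimp only at hY h
  set W := ∑ x, f x • M x with hW
  set k := ∑ x, outcome ρ M x * Real.log (f x)
  have hWp : W.PosSemidef := posSemidef_sum _ fun x _ => (hM.posSemidef x).smul (hf x).le
  have hT := posSemidef_link hσ.posSemidef.transpose hWp
  -- The minimax bound says tr[J(Y ⊗ 1 − `link σᵀ W`)] > −r at trace N. Adding r/N to Y makes this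
  -- positive and raises tr Y by r.
  set r : ℝ := k - Y.trace.re + 1 - c' with hr
  refine ⟨m, M, f, Y + (r / N) • 1, hM, hf, ?_, ?_⟩
  · set H := (Y + (r / N) • (1 : Matrix E E ℂ)) ⊗ₖ (1 : Matrix D D ℂ) - link σᵀ W with hH
    have hHH : H.IsHermitian := by
      refine IsHermitian.sub ?_ hT.isHermitian
      rw [IsHermitian, conjTranspose_kronecker, conjTranspose_add, hY, conjTranspose_smul,
        star_trivial, conjTranspose_one, conjTranspose_one]
    have hpos : ∀ J : Matrix (E × D) (E × D) ℂ, J.PosSemidef → J.trace = N →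
        0 < (J * H).trace.re := by
      intro J hJ hJN
      have h1 := h J hJ hJN
      have h2 : H = (Y ⊗ₖ (1 : Matrix D D ℂ) - link σᵀ W) + (r / N) • 1 := by
        rw [hH, add_kronecker, smul_kronecker, one_kronecker_one]
        abel
      rw [h2, Matrix.mul_add, trace_add, Matrix.mul_smul, Matrix.mul_one, trace_smul, hJN,
        Complex.add_re, Complex.smul_re, Complex.ofReal_re, smul_eq_mul, div_mul_cancel₀ _ hN0.ne']
      simp only [lagrangian] at h1
      linarith
    -- Rank-one J, rescaled to trace N, detect positivity of H.
    refine PosSemidef.of_dotProduct_mulVec_nonneg hHH fun v => ?_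
    by_cases hv : v = 0
    · simp [hv]
    obtain ⟨s, hs, hsN⟩ := hscale v hv
    have h1 := hpos _ ((posSemidef_vecMulVec_self_star v).smul hs.le) hsN
    rw [Matrix.smul_mul, trace_smul, Complex.smul_re, smul_eq_mul, trace_mul_comm,
      mul_vecMulVec, trace_vecMulVec, dotProduct_comm] at h1
    exact Complex.nonneg_iff.2 ⟨(pos_of_mul_pos_right h1 hs.le).le,
      (hHH.im_star_dotProduct_mulVec_self v).symm⟩
  · have h3 : (Y + (r / N) • (1 : Matrix E E ℂ)).trace.re = Y.trace.re + r := by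
      rw [trace_add, trace_smul, trace_one, Complex.add_re, Complex.smul_re, Complex.natCast_re,
        ← hN, smul_eq_mul, div_mul_cancel₀ _ hN0.ne']
    rw [h3]
    linarith

end Duality

/-! ### Tensor products of states, POVMs and link products -/

section Tensor

variable {A D E A' D' E' : Type*}

theorem posSemidef_systemTensor [Finite A] [Finite D] [Finite A'] [Finite D']
    {X : Matrix (A × D) (A × D) ℂ} {Y : Matrix (A' × D') (A' × D') ℂ}
    (hX : X.PosSemidef) (hY : Y.PosSemidef) : (systemTensor X Y).PosSemidef :=
  (hX.kronecker hY).submatrix _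

theorem systemTensor_add (X : Matrix (A × D) (A × D) ℂ) (Y Y' : Matrix (A' × D') (A' × D') ℂ) :
    systemTensor X (Y + Y') = systemTensor X Y + systemTensor X Y' := by
  ext; simp [systemTensor, mul_add]

theorem add_systemTensor (X X' : Matrix (A × D) (A × D) ℂ) (Y : Matrix (A' × D') (A' × D') ℂ) :
    systemTensor (X + X') Y = systemTensor X Y + systemTensor X' Y := by
  ext; simp [systemTensor, add_mul]

theorem systemTensor_transpose (X : Matrix (A × D) (A × D) ℂ)
    (Y : Matrix (A' × D') (A' × D') ℂ) : (systemTensor X Y)ᵀ = systemTensor Xᵀ Yᵀ := rfl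

theorem systemTensor_kronecker_one [DecidableEq D] [DecidableEq D'] (Y : Matrix E E ℂ)
    (Y' : Matrix E' E' ℂ) :
    systemTensor (Y ⊗ₖ (1 : Matrix D D ℂ)) (Y' ⊗ₖ (1 : Matrix D' D' ℂ)) =
      (Y ⊗ₖ Y') ⊗ₖ (1 : Matrix (D × D') (D × D') ℂ) := by
  rw [← one_kronecker_one (α := ℂ)]
  ext p q
  simp only [systemTensor, reindex_apply, submatrix_apply, kroneckerMap_apply,
    Equiv.prodProdProdComm_symm, Equiv.prodProdProdComm_apply]
  ring

variable [Fintype A] [Fintype D] [Fintype A'] [Fintype D']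

theorem systemTensor_mul (X Z : Matrix (A × D) (A × D) ℂ) (Y V : Matrix (A' × D') (A' × D') ℂ) :
    systemTensor X Y * systemTensor Z V = systemTensor (X * Z) (Y * V) := by
  rw [systemTensor, systemTensor, systemTensor, mul_kronecker_mul]
  simp only [reindex_apply]
  exact submatrix_mul_equiv _ _ _ _ _

theorem trace_systemTensor (X : Matrix (A × D) (A × D) ℂ) (Y : Matrix (A' × D') (A' × D') ℂ) :
    (systemTensor X Y).trace = X.trace * Y.trace := by
  rw [← trace_kronecker]
  exact (Equiv.prodProdProdComm A D A' D').symm.sum_comp fun i => (X ⊗ₖ Y) i i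

theorem IsDensity.systemTensor {X : Matrix (A × D) (A × D) ℂ} {Y : Matrix (A' × D') (A' × D') ℂ}
    (hX : IsDensity X) (hY : IsDensity Y) : IsDensity (systemTensor X Y) :=
  ⟨posSemidef_systemTensor hX.posSemidef hY.posSemidef, by
    rw [trace_systemTensor, hX.trace_eq_one, hY.trace_eq_one, one_mul]⟩

omit [Fintype D] [Fintype D'] in
theorem link_systemTensor (X : Matrix (A × E) (A × E) ℂ) (X' : Matrix (A' × E') (A' × E') ℂ)
    (Z : Matrix (A × D) (A × D) ℂ) (Z' : Matrix (A' × D') (A' × D') ℂ) :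
    link (systemTensor X X') (systemTensor Z Z') = systemTensor (link X Z) (link X' Z') := by
  ext p q
  simp only [link, systemTensor, reindex_apply, submatrix_apply, kroneckerMap_apply, of_apply,
    Equiv.prodProdProdComm_symm, Equiv.prodProdProdComm_apply, Fintype.sum_prod_type,
    Finset.sum_mul_sum]
  refine Finset.sum_congr rfl fun a _ => ?_
  refine Finset.sum_congr rfl fun a' _ => ?_
  refine Finset.sum_congr rfl fun b _ => ?_
  refine Finset.sum_congr rfl fun b' _ => ?_
  ring

/-- The tensor product is monotone on positive operators. -/
theorem posSemidef_systemTensor_sub {X T : Matrix (A × D) (A × D) ℂ}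
    {Y S : Matrix (A' × D') (A' × D') ℂ} (hT : T.PosSemidef) (hS : S.PosSemidef)
    (hX : (X - T).PosSemidef) (hY : (Y - S).PosSemidef) :
    (systemTensor X Y - systemTensor T S).PosSemidef := by
  have h : systemTensor X Y - systemTensor T S =
      systemTensor (X - T) (Y - S) + systemTensor (X - T) S + systemTensor T (Y - S) := by
    obtain ⟨P, rfl⟩ : ∃ P, X = P + T := ⟨X - T, by simp⟩
    obtain ⟨Q, rfl⟩ : ∃ Q, Y = Q + S := ⟨Y - S, by simp⟩
    simp only [add_sub_cancel_right, systemTensor_add, add_systemTensor]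
    abel
  rw [h]
  exact ((posSemidef_systemTensor hX hY).add (posSemidef_systemTensor hX hS)).add
    (posSemidef_systemTensor hT hY)

section POVM

variable [DecidableEq A] [DecidableEq D] [DecidableEq A'] [DecidableEq D']
  {X X' : Type*} [Fintype X] [Fintype X'] {M : X → Matrix (A × D) (A × D) ℂ}
  {M' : X' → Matrix (A' × D') (A' × D') ℂ}

omit [DecidableEq A] [DecidableEq D] [DecidableEq A'] [DecidableEq D'] [Fintype A] [Fintype D]
  [Fintype A'] [Fintype D'] in
theorem sum_systemTensor (F : X → Matrix (A × D) (A × D) ℂ) (F' : X' → Matrix (A' × D') (A' × D') ℂ) :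
    ∑ x : X × X', systemTensor (F x.1) (F' x.2) = systemTensor (∑ x, F x) (∑ x, F' x) := by
  ext p q
  simp only [Matrix.sum_apply, systemTensor, reindex_apply, submatrix_apply, kroneckerMap_apply,
    Fintype.sum_prod_type, Finset.sum_mul_sum]

theorem IsPOVM.systemTensor (hM : IsPOVM M) (hM' : IsPOVM M') :
    IsPOVM fun x : X × X' => systemTensor (M x.1) (M' x.2) where
  posSemidef x := posSemidef_systemTensor (hM.posSemidef _) (hM'.posSemidef _)
  sum_eq_one := by
    rw [sum_systemTensor, hM.sum_eq_one, hM'.sum_eq_one, RecoveryEntropy.systemTensor,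
      one_kronecker_one, reindex_apply, submatrix_one_equiv]

omit [DecidableEq A'] [DecidableEq D'] [Fintype X'] in
theorem outcome_systemTensor {ρ : Matrix (A × D) (A × D) ℂ} {τ : Matrix (A' × D') (A' × D') ℂ}
    (hρ : ρ.PosSemidef) (hM : IsPOVM M) (x : X × X') :
    outcome (systemTensor ρ τ) (fun x : X × X' => systemTensor (M x.1) (M' x.2)) x =
      outcome ρ M x.1 * outcome τ M' x.2 := by
  have h := (Complex.nonneg_iff.1 (trace_mul_nonneg (hM.posSemidef x.1) hρ)).2
  rw [outcome, systemTensor_mul, trace_systemTensor, Complex.mul_re, ← h, zero_mul, sub_zero]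
  rfl

end POVM

end Tensor

/-! ### Combining certificates -/

section Superadditivity

variable {A D E A' D' E' : Type*}
    [Fintype A] [Fintype D] [Fintype E] [Fintype A'] [Fintype D'] [Fintype E']
    [DecidableEq A] [DecidableEq D] [DecidableEq A'] [DecidableEq D']

omit [DecidableEq A] [DecidableEq A'] in
/-- Product dual certificates bound the test value of every joint channel. -/
theorem trace_mul_idTensor_systemTensor_le
    {σ : Matrix (A × E) (A × E) ℂ} {ω : Matrix (A' × E') (A' × E') ℂ}
    {W : Matrix (A × D) (A × D) ℂ} {W' : Matrix (A' × D') (A' × D') ℂ}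
    {Y : Matrix E E ℂ} {Y' : Matrix E' E' ℂ}
    (hσ : σ.PosSemidef) (hω : ω.PosSemidef) (hW : W.PosSemidef) (hW' : W'.PosSemidef)
    (hY : (Y ⊗ₖ (1 : Matrix D D ℂ) - link σᵀ W).PosSemidef)
    (hY' : (Y' ⊗ₖ (1 : Matrix D' D' ℂ) - link ωᵀ W').PosSemidef)
    {Γ : Matrix (E × E') (E × E') ℂ →ₗ[ℂ] Matrix (D × D') (D × D') ℂ} (hΓ : IsChannel Γ) :
    (systemTensor W W' * idTensor (A × A') Γ (systemTensor σ ω)).trace ≤ Y.trace * Y'.trace := by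
  classical
  have h := trace_mul_nonneg hΓ.posSemidef_choi (posSemidef_systemTensor_sub
    (posSemidef_link hσ.transpose hW) (posSemidef_link hω.transpose hW') hY hY')
  rw [systemTensor_kronecker_one, ← link_systemTensor, ← systemTensor_transpose, Matrix.mul_sub,
    trace_sub, trace_mul_kronecker_one, hΓ.marginal_choi, one_mul, trace_kronecker,
    ← trace_mul_idTensor_ofChoi, ofChoi_choi] at h
  exact sub_nonneg.1 h

omit [DecidableEq A] [DecidableEq D] in
theorem IsChannel.isDensity_idTensor {Γ : Matrix E E ℂ →ₗ[ℂ] Matrix D D ℂ} (hΓ : IsChannel Γ)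
    {σ : Matrix (A × E) (A × E) ℂ} (hσ : IsDensity σ) : IsDensity (idTensor A Γ σ) := by
  classical
  refine ⟨?_, (trace_idTensor hΓ σ).trans hσ.trace_eq_one⟩
  rw [← ofChoi_choi Γ]
  exact posSemidef_idTensor_ofChoi hΓ.posSemidef_choi hσ.posSemidef

-- Feasibility gives Y ⊗ 1 ≥ `link σᵀ W` ≥ 0; compressing to one basis vector of D leaves Y ≥ 0.
omit [DecidableEq A] in
theorem trace_nonneg_of_dual_feasible {σ : Matrix (A × E) (A × E) ℂ}
    {W : Matrix (A × D) (A × D) ℂ} {Y : Matrix E E ℂ} [Nonempty D]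
    (hσ : σ.PosSemidef) (hW : W.PosSemidef)
    (hY : (Y ⊗ₖ (1 : Matrix D D ℂ) - link σᵀ W).PosSemidef) : 0 ≤ Y.trace := by
  have h := (hY.add (posSemidef_link hσ.transpose hW)).submatrix
    fun e => (e, Classical.arbitrary D)
  rw [sub_add_cancel] at h
  simpa [Matrix.trace] using h.trace_nonneg

theorem sum_outcome_systemTensor_mul_log {X X' : Type*} [Fintype X] [Fintype X']
    {ρ : Matrix (A × D) (A × D) ℂ} {τ : Matrix (A' × D') (A' × D') ℂ}
    (hρ : IsDensity ρ) (hτ : IsDensity τ) {M : X → Matrix (A × D) (A × D) ℂ}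
    {M' : X' → Matrix (A' × D') (A' × D') ℂ} (hM : IsPOVM M) (hM' : IsPOVM M')
    {f : X → ℝ} {f' : X' → ℝ} (hf : ∀ x, 0 < f x) (hf' : ∀ x, 0 < f' x) {s : ℝ} (hs : 0 < s) :
    ∑ x : X × X', outcome (systemTensor ρ τ) (fun x => systemTensor (M x.1) (M' x.2)) x *
        Real.log (s * (f x.1 * f' x.2)) =
      Real.log s + ∑ x, outcome ρ M x * Real.log (f x) +
        ∑ x, outcome τ M' x * Real.log (f' x) := by
  have h1 := sum_outcome hρ.trace_eq_one hM
  have h2 := sum_outcome hτ.trace_eq_one hM'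
  simp only [outcome_systemTensor hρ.posSemidef hM, Real.log_mul hs.ne'
    (mul_pos (hf _) (hf' _)).ne', Real.log_mul (hf _).ne' (hf' _).ne', Fintype.sum_prod_type]
  calc _ = ∑ x, ∑ x', (outcome ρ M x * outcome τ M' x' * Real.log s +
        (outcome ρ M x * Real.log (f x)) * outcome τ M' x' +
        outcome ρ M x * (outcome τ M' x' * Real.log (f' x'))) :=
      Finset.sum_congr rfl fun x _ => Finset.sum_congr rfl fun x' _ => by ring
    _ = _ := by
      simp only [Finset.sum_add_distrib, ← Finset.sum_mul, ← Finset.sum_mul_sum, h1, h2]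
      ring

end Superadditivity

end RecoveryEntropy

open RecoveryEntropy in
theorem proposition6 {A D E A' D' E' : Type*}
    [Fintype A] [Fintype D] [Fintype E] [Fintype A'] [Fintype D'] [Fintype E']
    [DecidableEq A] [DecidableEq D] [DecidableEq A'] [DecidableEq D']
    (ρ : Matrix (A × D) (A × D) ℂ) (τ : Matrix (A' × D') (A' × D') ℂ)
    (σ : Matrix (A × E) (A × E) ℂ) (ω : Matrix (A' × E') (A' × E') ℂ)
    (hρ : RecoveryEntropy.IsDensity ρ) (hτ : RecoveryEntropy.IsDensity τ)
    (hσ : RecoveryEntropy.IsDensity σ) (hω : RecoveryEntropy.IsDensity ω)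
    (hσA : (RecoveryEntropy.marginal σ).PosDef) (hωA : (RecoveryEntropy.marginal ω).PosDef) :
    RecoveryEntropy.measuredRelEntropyRec ρ σ + RecoveryEntropy.measuredRelEntropyRec τ ω ≤
      RecoveryEntropy.measuredRelEntropyRec (RecoveryEntropy.systemTensor ρ τ)
        (RecoveryEntropy.systemTensor σ ω) := by
  have : Nonempty D := by
    by_contra h
    rw [not_nonempty_iff] at h
    simpa [Matrix.trace] using hρ.trace_eq_one
  have : Nonempty D' := by
    by_contra h
    rw [not_nonempty_iff] at h
    simpa [Matrix.trace] using hτ.trace_eq_one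
  refine EReal.add_le_of_forall_lt fun a ha a' ha' => le_iInf₂ fun Γ hΓ => ?_
  obtain ⟨c, hac, hc⟩ := EReal.lt_iff_exists_real_btwn.1 ha
  obtain ⟨c', hac', hc'⟩ := EReal.lt_iff_exists_real_btwn.1 ha'
  obtain ⟨m, M, f, Y, hM, hf, hY, h⟩ := exists_dual_certificate hρ hσ hc
  obtain ⟨m', M', f', Y', hM', hf', hY', h'⟩ := exists_dual_certificate hτ hω hc'
  have hW : (∑ x, f x • M x).PosSemidef :=
    Matrix.posSemidef_sum _ fun x _ => (hM.posSemidef x).smul (hf x).le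
  have hW' : (∑ x, f' x • M' x).PosSemidef :=
    Matrix.posSemidef_sum _ fun x _ => (hM'.posSemidef x).smul (hf' x).le
  set k := ∑ x, outcome ρ M x * Real.log (f x)
  set k' := ∑ x, outcome τ M' x * Real.log (f' x)
  obtain ⟨hy0, hy0'⟩ := Complex.nonneg_iff.1 (trace_nonneg_of_dual_feasible hσ.posSemidef hW hY)
  obtain ⟨hz0, hz0'⟩ := Complex.nonneg_iff.1 (trace_nonneg_of_dual_feasible hω.posSemidef hW' hY')
  -- The trace of Y is only known to be nonnegative; y sits strictly above it so that inverses and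
  -- logarithms are available.
  obtain ⟨y, hy, hyc⟩ : ∃ y, Y.trace.re < y ∧ y < k + 1 - c :=
    exists_between (by linarith)
  obtain ⟨z, hz, hzc⟩ : ∃ z, Y'.trace.re < z ∧ z < k' + 1 - c' :=
    exists_between (by linarith)
  have hy1 : 0 < y := hy0.trans_lt hy
  have hz1 : 0 < z := hz0.trans_lt hz
  have hs : 0 < (y * z)⁻¹ := inv_pos.2 (mul_pos hy1 hz1)
  have hρτ := hρ.systemTensor hτ
  have hMM := hM.systemTensor hM'
  have hΓd := hΓ.isDensity_idTensor (hσ.systemTensor hω)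
  have key := sum_log_sub_le_klDivergence
    (outcome_nonneg hρτ.posSemidef hMM) (outcome_nonneg hΓd.posSemidef hMM)
    (sum_outcome hρτ.trace_eq_one hMM)
    -- The factor 1/(y z) normalises the linear term to at most 1, turning the product of traces
    -- into a sum of logarithms.
    (f := fun x => (y * z)⁻¹ * (f x.1 * f' x.2))
    (fun x => mul_pos hs (mul_pos (hf _) (hf' _)))
  refine le_trans ?_ (key.trans (klDivergence_le_measuredRelEntropy hMM))
  rw [sum_outcome_systemTensor_mul_log hρ hτ hM hM' hf hf' hs,
    sum_outcome_mul (idTensor (A × A') Γ (systemTensor σ ω))]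
  have hsum : ∑ x : Fin m × Fin m', ((y * z)⁻¹ * (f x.1 * f' x.2)) •
      systemTensor (M x.1) (M' x.2) =
      (y * z)⁻¹ • systemTensor (∑ x, f x • M x) (∑ x, f' x • M' x) := by
    rw [← sum_systemTensor, Finset.smul_sum]
    refine Finset.sum_congr rfl fun x _ => ?_
    ext p q
    simp [systemTensor]
    ring
  rw [hsum, Matrix.smul_mul, Matrix.trace_smul, Complex.smul_re, smul_eq_mul]
  have hq := (Complex.le_def.1 (trace_mul_idTensor_systemTensor_le hσ.posSemidef hω.posSemidef
    hW hW' hY hY' hΓ)).1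
  rw [Complex.mul_re, ← hy0', zero_mul, sub_zero] at hq
  have hq1 := mul_le_mul_of_nonneg_left
    (hq.trans (mul_le_mul hy.le hz.le hz0 hy1.le)) hs.le
  rw [inv_mul_cancel₀ (mul_pos hy1 hz1).ne'] at hq1
  rw [Real.log_inv, Real.log_mul hy1.ne' hz1.ne']
  have hly := Real.log_le_sub_one_of_pos hy1
  have hlz := Real.log_le_sub_one_of_pos hz1
  refine (add_le_add hac.le hac'.le).trans ?_
  rw [← EReal.coe_add, EReal.coe_le_coe_iff]
  linarith
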